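/- For every $n\ge 1$ let $R_1^{(n)},\dots,R_n^{(n)}$ be independent random variables, where $R_i^{(n)}$ is uniformly distributed on $\{0,1,\dots,n-i\}$ (for different $n$ these may live on different probability spaces). Let $(a_n)$ be a deterministic sequence of real numbers with $a_n/n\to a$ for some $a\in(0,1)$, and set \[f(a_n)=\sum_{i=1}^{\lfloor a_n\rfloor}\left(R_i^{(n)}-\frac{n-i}{2}\right),\] where the sum is empty if $a_n<1$, and where for the at most finitely many $n$ with $\lfloor a_n\rfloor>n$ the variables $R_i^{(n)}$ with $i>n$ are arbitrary random variables with values in $\{0,1,2,\dots\}$. Then \[\frac{f(a_n)}{n^{3/2}}\Rightarrow \mathcal N\left(0,\frac{1-(1-a)^3}{36}\right)\] in distribution as $n\to\infty$, where $\mathcal N(\mu,\sigma^2)$ is the normal distribution with mean $\mu$ and variance $\sigma^2$. -/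

import Mathlib

open MeasureTheory ProbabilityTheory Filter Topology

/-!
The summands, divided by `n ^ (3 / 2)`, form a triangular array of independent centred variables
that are bounded by `n ^ (-1 / 2)` in the `n`-th row, so the claim is an instance of Lyapunov's
central limit theorem. Mathlib has the central limit theorem only for identically distributed
variables; `tendstoInDistribution_sum_of_bounded` supplies the version for bounded arrays.

It is proved with characteristic functions and Lévy's convergence theorem. By independence the
characteristic function of a row sum is a product; `norm_charFun_map_sub_exp_le` compares each
factor with that of a Gaussian of the same variance, with an error cubic in the bound, and
`norm_prod_sub_prod_le_sum` adds up the errors, since all factors have norm at most one. Here there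
are at most `n` factors for large `n`, each with an error of order `n ^ (-3 / 2)`.

What remains is the variance. A uniform variable on `{0, …, m}` has variance
`((m + 1) ^ 2 - 1) / 12`, and the sum of these over `m = n - i`, `1 ≤ i ≤ ⌊s n⌋₊`, divided by
`n ^ 3`, is a polynomial in `⌊s n⌋₊ / n` and `1 / n`, which tends to `(1 - (1 - a) ^ 3) / 36`.
-/

/-! ### The characteristic function of a bounded centred variable -/

/-- The second-order Taylor estimate of `exp (ix)` against `exp (-x²/2)`, integrated: the linear
term vanishes because `X` is centred, and both remainders are cubic in the bound on `u X`. -/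
theorem norm_charFun_map_sub_exp_le {Ω : Type*} [MeasurableSpace Ω] {P : Measure Ω}
    [IsProbabilityMeasure P] {X : Ω → ℝ} (hX : AEMeasurable X P) {B u : ℝ}
    (hB : ∀ᵐ ω ∂P, |X ω| ≤ B) (h0 : ∫ ω, X ω ∂P = 0) (hu : |u| * B ≤ 1) :
    ‖charFun (P.map X) u - (Real.exp (-(u ^ 2 * ∫ ω, X ω ^ 2 ∂P) / 2) : ℂ)‖
      ≤ 2 * (|u| * B) ^ 3 := by
  have hB0 : 0 ≤ B := by
    obtain ⟨ω, hω⟩ := hB.exists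
    exact (abs_nonneg _).trans hω
  set b : ℝ := |u| * B with hb
  have hb0 : 0 ≤ b := by positivity
  set v : ℝ := ∫ ω, X ω ^ 2 ∂P with hv
  have hv0 : 0 ≤ v := integral_nonneg fun ω => sq_nonneg _
  have hX1 : Integrable X P := Integrable.of_bound hX.aestronglyMeasurable B hB
  have hX2 : Integrable (fun ω => X ω ^ 2) P := by
    refine Integrable.of_bound (hX.pow_const 2).aestronglyMeasurable (B ^ 2) ?_
    filter_upwards [hB] with ω hω
    rw [norm_pow]
    exact pow_le_pow_left₀ (norm_nonneg _) hω 2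
  have hvB : v ≤ B ^ 2 := by
    have : v ≤ ∫ _, B ^ 2 ∂P := by
      refine integral_mono_ae hX2 (integrable_const _) ?_
      filter_upwards [hB] with ω hω
      exact sq_le_sq' (neg_le_of_abs_le hω) (le_of_abs_le hω)
    simpa using this
  have hchar : charFun (P.map X) u = ∫ ω, Complex.exp (u * X ω * Complex.I) ∂P := by
    rw [charFun_apply_real, integral_map hX (by fun_prop)]
  have hE : Integrable (fun ω => Complex.exp (u * X ω * Complex.I)) P := by
    refine Integrable.of_bound (C := 1) ?_ (ae_of_all _ fun ω => ?_)
    · have : AEMeasurable (fun ω => Complex.exp (u * X ω * Complex.I)) P := by fun_prop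
      exact this.aestronglyMeasurable
    · rw [← Complex.ofReal_mul, Complex.norm_exp_ofReal_mul_I]
  have hT1 : Integrable (fun ω => (u * Complex.I) * (X ω : ℂ)) P := hX1.ofReal.const_mul _
  have hT2 : Integrable (fun ω => (u ^ 2 / 2 : ℂ) * ((X ω ^ 2 : ℝ) : ℂ)) P :=
    hX2.ofReal.const_mul _
  have hint : ∫ ω, (Complex.exp (u * X ω * Complex.I) - 1 - (u * Complex.I) * (X ω : ℂ)
      + (u ^ 2 / 2 : ℂ) * ((X ω ^ 2 : ℝ) : ℂ)) ∂P
      = charFun (P.map X) u - 1 + (u ^ 2 / 2 : ℂ) * v := by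
    have hE1 : Integrable (fun ω => Complex.exp (u * X ω * Complex.I) - 1) P :=
      hE.sub (integrable_const 1)
    have hE2 : Integrable (fun ω => Complex.exp (u * X ω * Complex.I) - 1
        - (u * Complex.I) * (X ω : ℂ)) P := hE1.sub hT1
    rw [integral_add hE2 hT2, integral_sub hE1 hT1, integral_sub hE (integrable_const 1),
      integral_const_mul, integral_const_mul, integral_complex_ofReal, integral_complex_ofReal, h0,
      hchar]
    simp [hv]
  have h1 : ‖charFun (P.map X) u - 1 + (u ^ 2 / 2 : ℂ) * v‖ ≤ b ^ 3 := by
    rw [← hint]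
    have hbd : ∀ᵐ ω ∂P, ‖Complex.exp (u * X ω * Complex.I) - 1 - (u * Complex.I) * (X ω : ℂ)
      + (u ^ 2 / 2 : ℂ) * ((X ω ^ 2 : ℝ) : ℂ)‖ ≤ b ^ 3 := by
      filter_upwards [hB] with ω hω
      have hz : ‖(u * X ω * Complex.I : ℂ)‖ ≤ b := by
        simp only [norm_mul, Complex.norm_real, Complex.norm_I, mul_one, Real.norm_eq_abs]
        exact mul_le_mul_of_nonneg_left hω (abs_nonneg _)
      have hexp := Complex.exp_bound (hz.trans hu) (n := 3) (by norm_num)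
      have hsum : ∑ m ∈ Finset.range 3, (u * X ω * Complex.I : ℂ) ^ m / (m.factorial : ℂ)
          = 1 + (u * Complex.I) * (X ω : ℂ) - (u ^ 2 / 2 : ℂ) * ((X ω ^ 2 : ℝ) : ℂ) := by
        simp only [Finset.sum_range_succ, Finset.range_zero, Finset.sum_empty, mul_pow,
          Complex.I_sq, Nat.factorial]
        push_cast
        ring
      rw [hsum] at hexp
      refine (le_of_eq ?_).trans (hexp.trans ?_)
      · congr 1
        ring
      · calc _ ≤ ‖(u * X ω * Complex.I : ℂ)‖ ^ 3 * 1 := by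
              gcongr
              norm_num [Nat.factorial]
          _ ≤ b ^ 3 := by
              rw [mul_one]
              gcongr
    simpa using norm_integral_le_of_norm_le_const hbd
  have hw : u ^ 2 * v ≤ b ^ 2 := by
    rw [hb, mul_pow, sq_abs]
    gcongr
  have hb2 : b ^ 2 ≤ 1 := pow_le_one₀ hb0 hu
  have h2 : |Real.exp (-(u ^ 2 * v) / 2) - 1 - (-(u ^ 2 * v) / 2)| ≤ b ^ 3 := by
    have habs : ‖-(u ^ 2 * v) / 2‖ = u ^ 2 * v / 2 := by
      rw [neg_div, norm_neg, Real.norm_of_nonneg (by positivity)]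
    refine (Real.norm_exp_sub_one_sub_id_le (by rw [habs]; linarith)).trans ?_
    rw [habs]
    have : b ^ 2 * b ^ 2 ≤ b ^ 3 := by
      have : b ^ 3 * b ≤ b ^ 3 * 1 := by gcongr
      linarith
    have : (u ^ 2 * v) ^ 2 ≤ (b ^ 2) ^ 2 := by gcongr
    nlinarith [sq_nonneg (u ^ 2 * v)]
  have hsplit : charFun (P.map X) u - (Real.exp (-(u ^ 2 * v) / 2) : ℂ)
      = (charFun (P.map X) u - 1 + (u ^ 2 / 2 : ℂ) * v)
        - ((Real.exp (-(u ^ 2 * v) / 2) - 1 - (-(u ^ 2 * v) / 2) : ℝ) : ℂ) := by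
    push_cast
    ring
  rw [hsplit]
  refine (norm_sub_le _ _).trans ?_
  rw [Complex.norm_real, Real.norm_eq_abs]
  linarith

/-! ### A central limit theorem for bounded triangular arrays -/

theorem norm_prod_sub_prod_le_sum {ι R : Type*} [NormedCommRing R] [NormOneClass R]
    (s : Finset ι) (f g : ι → R) (hf : ∀ i ∈ s, ‖f i‖ ≤ 1) (hg : ∀ i ∈ s, ‖g i‖ ≤ 1) :
    ‖∏ i ∈ s, f i - ∏ i ∈ s, g i‖ ≤ ∑ i ∈ s, ‖f i - g i‖ := by
  classical
  induction s using Finset.induction_on with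
  | empty => simp
  | insert j s hj ih =>
    simp only [Finset.mem_insert, forall_eq_or_imp] at hf hg
    rw [Finset.prod_insert hj, Finset.prod_insert hj, Finset.sum_insert hj]
    have hG : ‖∏ i ∈ s, g i‖ ≤ 1 :=
      (Finset.norm_prod_le _ _).trans (Finset.prod_le_one (fun _ _ => norm_nonneg _) hg.2)
    calc ‖f j * ∏ i ∈ s, f i - g j * ∏ i ∈ s, g i‖
        = ‖(f j - g j) * ∏ i ∈ s, g i + f j * (∏ i ∈ s, f i - ∏ i ∈ s, g i)‖ := by
          congr 1
          ring
      _ ≤ ‖f j - g j‖ * ‖∏ i ∈ s, g i‖ + ‖f j‖ * ‖∏ i ∈ s, f i - ∏ i ∈ s, g i‖ :=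
          (norm_add_le _ _).trans (add_le_add (norm_mul_le _ _) (norm_mul_le _ _))
      _ ≤ ‖f j - g j‖ * 1 + 1 * ∑ i ∈ s, ‖f i - g i‖ := by
          gcongr
          · exact hf.1
          · exact ih hf.2 hg.2
      _ = _ := by ring

/-- A Lyapunov-type central limit theorem: the rows of the array are independent and centred, the
`n`-th row is bounded by `B n`, the total variances converge, and the third-moment bound
`#(I n) * B n ^ 3` tends to zero. The hypotheses on the rows are needed only for large `n`. -/
theorem tendstoInDistribution_sum_of_bounded {ι : Type*} {Ω : ℕ → Type*}
    [∀ n, MeasurableSpace (Ω n)] {P : (n : ℕ) → Measure (Ω n)} [∀ n, IsProbabilityMeasure (P n)]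
    {X : (n : ℕ) → ι → Ω n → ℝ} {I : ℕ → Finset ι} {B : ℕ → ℝ} {V : NNReal}
    (hmeas : ∀ n i, AEMeasurable (X n i) (P n))
    (hindep : ∀ᶠ n in atTop, iIndepFun ((I n).restrict (X n)) (P n))
    (hbound : ∀ᶠ n in atTop, ∀ i ∈ I n, ∀ᵐ ω ∂(P n), |X n i ω| ≤ B n)
    (hmean : ∀ᶠ n in atTop, ∀ i ∈ I n, ∫ ω, X n i ω ∂(P n) = 0)
    (hB : Tendsto B atTop (𝓝 0))
    (hcard : Tendsto (fun n => ((I n).card : ℝ) * B n ^ 3) atTop (𝓝 0))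
    (hvar : Tendsto (fun n => ∑ i ∈ I n, ∫ ω, X n i ω ^ 2 ∂(P n)) atTop (𝓝 (V : ℝ))) :
    TendstoInDistribution (fun n ω => ∑ i ∈ I n, X n i ω) atTop (id : ℝ → ℝ) P
      (gaussianReal 0 V) where
  forall_aemeasurable n := Finset.aemeasurable_fun_sum _ fun i _ => hmeas n i
  tendsto := by
    refine ProbabilityMeasure.tendsto_iff_tendsto_charFun.2 fun t => ?_
    simp only [ProbabilityMeasure.coe_mk, Measure.map_id, charFun_gaussianReal]
    have hgauss : Tendsto (fun n => ∏ i ∈ I n,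
        (Real.exp (-(t ^ 2 * ∫ ω, X n i ω ^ 2 ∂(P n)) / 2) : ℂ)) atTop
        (𝓝 (Complex.exp (t * (0 : ℝ) * Complex.I - (V : ℝ) * t ^ 2 / 2))) := by
      have h1 : Tendsto (fun n => Real.exp (-(t ^ 2 * ∑ i ∈ I n, ∫ ω, X n i ω ^ 2 ∂(P n)) / 2))
          atTop (𝓝 (Real.exp (-(t ^ 2 * V) / 2))) :=
        (Real.continuous_exp.tendsto _).comp (((hvar.const_mul (t ^ 2)).neg).div_const 2)
      convert! (Complex.continuous_ofReal.tendsto _).comp h1 using 2 with n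
      · simp only [Function.comp_apply]
        rw [← Complex.ofReal_prod, ← Real.exp_sum, Finset.mul_sum, ← Finset.sum_neg_distrib,
          Finset.sum_div]
      · push_cast
        congr 1
        ring
    have hdiff : Tendsto (fun n => charFun ((P n).map fun ω => ∑ i ∈ I n, X n i ω) t
        - ∏ i ∈ I n, (Real.exp (-(t ^ 2 * ∫ ω, X n i ω ^ 2 ∂(P n)) / 2) : ℂ)) atTop (𝓝 0) := by
      have hlim : Tendsto (fun n => 2 * |t| ^ 3 * (((I n).card : ℝ) * B n ^ 3)) atTop (𝓝 0) := by
        simpa using hcard.const_mul (2 * |t| ^ 3)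
      refine squeeze_zero_norm' ?_ hlim
      have hsmall : ∀ᶠ n in atTop, |t| * B n ≤ 1 := by
        have : Tendsto (fun n => |t| * B n) atTop (𝓝 0) := by simpa using hB.const_mul |t|
        exact (this.eventually_lt_const one_pos).mono fun n hn => hn.le
      filter_upwards [hindep, hbound, hmean, hsmall] with n hi hb hm hsm
      rw [hi.charFun_map_fun_finsetSum_eq_prod fun i _ => hmeas n i, Finset.prod_apply]
      refine (norm_prod_sub_prod_le_sum _ _ _ (fun i _ => ?_) fun i _ => ?_).trans ?_
      · have := Measure.isProbabilityMeasure_map (hmeas n i)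
        exact norm_charFun_le_one t
      · rw [Complex.norm_real, Real.norm_of_nonneg (Real.exp_pos _).le]
        refine Real.exp_le_one_iff.2 ?_
        have : 0 ≤ ∫ ω, X n i ω ^ 2 ∂(P n) := integral_nonneg fun ω => sq_nonneg _
        have : 0 ≤ t ^ 2 * ∫ ω, X n i ω ^ 2 ∂(P n) := by positivity
        linarith
      · refine (Finset.sum_le_card_nsmul _ _ (2 * (|t| * B n) ^ 3) fun i hin => ?_).trans
          (le_of_eq ?_)
        · exact norm_charFun_map_sub_exp_le (hmeas n i) (hb i hin) (hm i hin) hsm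
        · rw [nsmul_eq_mul]
          ring
    simpa using hdiff.add hgauss

/-! ### Moments of the discrete uniform law -/

theorem integral_uniformOn_Icc (m : ℕ) (f : ℕ → ℝ) :
    ∫ k, f k ∂(uniformOn (Set.Icc 0 m)) = (∑ k ∈ Finset.range (m + 1), f k) / (m + 1) := by
  have hset : Set.Icc 0 m = (Finset.range (m + 1) : Set ℕ) := by
    ext k
    simp
  have hint : IntegrableOn f (Finset.range (m + 1) : Set ℕ) Measure.count := by
    rw [← (Finset.range (m + 1) : Set ℕ).biUnion_of_singleton]
    exact integrableOn_finset_iUnion.2 fun k _ => by simp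
  rw [hset, uniformOn, ProbabilityTheory.cond, integral_smul_measure,
    Measure.count_apply_finset,
    setIntegral_finset _ hint, ENNReal.toReal_inv, ENNReal.toReal_natCast]
  simp [Measure.real, div_eq_inv_mul]

theorem integral_uniformOn_Icc_sub_half (m : ℕ) :
    ∫ k, ((k : ℝ) - (m : ℝ) / 2) ∂(uniformOn (Set.Icc 0 m)) = 0 := by
  have h : ∀ m : ℕ, ∀ c : ℝ, ∑ k ∈ Finset.range (m + 1), ((k : ℝ) - c)
      = (m + 1) * (m / 2 - c) := by
    intro m c
    induction m with
    | zero => simp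
    | succ m ih =>
      rw [Finset.sum_range_succ, ih]
      push_cast
      ring
  rw [integral_uniformOn_Icc m fun k => (k : ℝ) - (m : ℝ) / 2, h]
  simp

theorem integral_uniformOn_Icc_sub_half_sq (m : ℕ) :
    ∫ k, ((k : ℝ) - (m : ℝ) / 2) ^ 2 ∂(uniformOn (Set.Icc 0 m)) = (((m : ℝ) + 1) ^ 2 - 1) / 12 := by
  -- The centre is kept free, so that the induction on the range does not move it.
  have h : ∀ m : ℕ, ∀ c : ℝ, ∑ k ∈ Finset.range (m + 1), ((k : ℝ) - c) ^ 2
      = (m + 1) * (m * (2 * m + 1) / 6 - c * m + c ^ 2) := by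
    intro m c
    induction m with
    | zero => simp
    | succ m ih =>
      rw [Finset.sum_range_succ, ih]
      push_cast
      ring
  rw [integral_uniformOn_Icc m fun k => ((k : ℝ) - (m : ℝ) / 2) ^ 2, h]
  have : (m : ℝ) + 1 ≠ 0 := by positivity
  field_simp
  ring

/-! ### Asymptotics of the total variance -/

theorem tendsto_natFloor_div {s : ℕ → ℝ} {a : ℝ} (ha : 0 < a)
    (hs : Tendsto (fun n : ℕ => s n / (n : ℝ)) atTop (𝓝 a)) :
    Tendsto (fun n : ℕ => (⌊s n⌋₊ : ℝ) / (n : ℝ)) atTop (𝓝 a) := by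
  have hlow : Tendsto (fun n : ℕ => s n / (n : ℝ) - 1 / (n : ℝ)) atTop (𝓝 a) := by
    simpa using hs.sub tendsto_one_div_atTop_nhds_zero_nat
  refine tendsto_of_tendsto_of_tendsto_of_le_of_le' hlow hs ?_ ?_
  · filter_upwards with n
    rw [← sub_div]
    gcongr
    exact (Nat.sub_one_lt_floor _).le
  · filter_upwards [hs.eventually_const_lt ha] with n hn
    have : 0 ≤ s n := by
      by_contra h
      exact hn.not_ge (div_nonpos_of_nonpos_of_nonneg (not_le.1 h).le n.cast_nonneg)
    gcongr
    exact Nat.floor_le this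

theorem sum_Icc_sub_add_one_sq_sub_one (x : ℝ) (k : ℕ) :
    ∑ i ∈ Finset.Icc 1 k, ((x - i + 1) ^ 2 - 1)
      = k * (x + 1) ^ 2 - (x + 1) * (k * (k + 1)) + k * (k + 1) * (2 * k + 1) / 6 - k := by
  induction k with
  | zero => simp
  | succ k ih =>
    rw [Finset.sum_Icc_succ_top (by lia), ih]
    push_cast
    ring

theorem tendsto_sum_sub_add_one_sq_div {k : ℕ → ℕ} {a : ℝ}
    (hk : Tendsto (fun n : ℕ => (k n : ℝ) / (n : ℝ)) atTop (𝓝 a)) :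
    Tendsto (fun n : ℕ => ∑ i ∈ Finset.Icc 1 (k n), (((n : ℝ) - i + 1) ^ 2 - 1) / 12 / (n : ℝ) ^ 3)
      atTop (𝓝 ((1 - (1 - a) ^ 3) / 36)) := by
  have he : Tendsto (fun n : ℕ => 1 / (n : ℝ)) atTop (𝓝 0) := tendsto_one_div_atTop_nhds_zero_nat
  have hF : Continuous fun p : ℝ × ℝ => (p.1 * (1 + p.2) ^ 2 - (1 + p.2) * (p.1 * (p.1 + p.2))
      + p.1 * (p.1 + p.2) * (2 * p.1 + p.2) / 6 - p.1 * p.2 ^ 2) / 12 := by fun_prop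
  have hlim := (hF.tendsto (a, 0)).comp (hk.prodMk_nhds he)
  have hval : (1 - (1 - a) ^ 3) / 36 = (a * (1 + 0) ^ 2 - (1 + 0) * (a * (a + 0))
      + a * (a + 0) * (2 * a + 0) / 6 - a * 0 ^ 2) / 12 := by ring
  rw [hval]
  refine hlim.congr' ?_
  filter_upwards [eventually_gt_atTop 0] with n hn
  have hn' : (n : ℝ) ≠ 0 := by positivity
  rw [← Finset.sum_div, ← Finset.sum_div, sum_Icc_sub_add_one_sq_sub_one]
  simp only [Function.comp_apply]
  field_simp


/-- For each `n`, the variables `R n i`, `1 ≤ i ≤ n`, are independent and uniform on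
`{0, 1, …, n - i}`; the probability space may change with `n`. Nothing but measurability is asked
of `R n i` for the other indices `i`, which occur in the sum for at most finitely many `n`. -/
theorem proposition7p2
    {Ω : ℕ → Type*} [∀ n, MeasurableSpace (Ω n)]
    (P : (n : ℕ) → Measure (Ω n)) [∀ n, IsProbabilityMeasure (P n)]
    (R : (n : ℕ) → ℕ → Ω n → ℕ)
    (hmeas : ∀ n i, AEMeasurable (R n i) (P n))
    (hunif : ∀ n, ∀ i ∈ Finset.Icc 1 n,
      HasLaw (R n i) (uniformOn (Set.Icc 0 (n - i))) (P n))
    (hindep : ∀ n, iIndepFun (fun (i : Finset.Icc 1 n) => R n i) (P n))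
    (s : ℕ → ℝ) (a : ℝ) (ha : a ∈ Set.Ioo (0 : ℝ) 1)
    (hs : Tendsto (fun n : ℕ => s n / (n : ℝ)) atTop (𝓝 a)) :
    TendstoInDistribution
      (fun (n : ℕ) (ω : Ω n) =>
        (∑ i ∈ Finset.Icc 1 ⌊s n⌋₊, ((R n i ω : ℝ) - ((n : ℝ) - (i : ℝ)) / 2))
          / (n : ℝ) ^ (3 / 2 : ℝ))
      atTop (id : ℝ → ℝ) P
      (gaussianReal 0 (Real.toNNReal ((1 - (1 - a) ^ 3) / 36))) := by
  have hk := tendsto_natFloor_div ha.1 hs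
  have hkn : ∀ᶠ n : ℕ in atTop, ⌊s n⌋₊ ≤ n := by
    filter_upwards [hk.eventually_lt_const ha.2, eventually_gt_atTop 0] with n h hn
    have hn' : (0 : ℝ) < n := by exact_mod_cast hn
    rw [div_lt_one hn'] at h
    exact_mod_cast h.le
  have hmem : ∀ n i, ⌊s n⌋₊ ≤ n → i ∈ Finset.Icc 1 ⌊s n⌋₊ → i ∈ Finset.Icc 1 n :=
    fun n i h hi => Finset.Icc_subset_Icc_right h hi
  have hcast : ∀ n i, i ∈ Finset.Icc 1 n → ((n - i : ℕ) : ℝ) = (n : ℝ) - i :=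
    fun n i hi => Nat.cast_sub (Finset.mem_Icc.1 hi).2
  have hroot : ∀ n : ℕ, ((n : ℝ) ^ (3 / 2 : ℝ)) ^ 2 = (n : ℝ) ^ 3 := fun n => by
    rw [← Real.rpow_natCast, ← Real.rpow_mul n.cast_nonneg, ← Real.rpow_natCast]
    norm_num
  have hB_eq : ∀ᶠ n : ℕ in atTop, (n : ℝ) / (n : ℝ) ^ (3 / 2 : ℝ) = (n : ℝ) ^ (-(1 / 2) : ℝ) := by
    filter_upwards [eventually_gt_atTop 0] with n hn
    have hn' : (0 : ℝ) < n := by exact_mod_cast hn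
    rw [div_eq_iff (by positivity), ← Real.rpow_add hn']
    norm_num
  have hB : Tendsto (fun n : ℕ => (n : ℝ) / (n : ℝ) ^ (3 / 2 : ℝ)) atTop (𝓝 0) :=
    ((tendsto_rpow_neg_atTop (by norm_num : (0 : ℝ) < 1 / 2)).comp
      tendsto_natCast_atTop_atTop).congr' (hB_eq.mono fun n h => h.symm)
  simp_rw [Finset.sum_div]
  refine tendstoInDistribution_sum_of_bounded
    (X := fun n i ω => ((R n i ω : ℝ) - ((n : ℝ) - (i : ℝ)) / 2) / (n : ℝ) ^ (3 / 2 : ℝ))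
    (I := fun n => Finset.Icc 1 ⌊s n⌋₊) (B := fun n => (n : ℝ) / (n : ℝ) ^ (3 / 2 : ℝ))
    (fun n i => ?_) ?_ ?_ ?_ hB ?_ ?_
  · have : AEMeasurable (fun ω => (R n i ω : ℝ)) (P n) :=
      measurable_from_nat.comp_aemeasurable (hmeas n i)
    fun_prop
  · filter_upwards [hkn] with n hn
    have h := (hindep n).precomp (g := fun i : Finset.Icc 1 ⌊s n⌋₊ => ⟨i, hmem n i hn i.2⟩)
      fun i j hij => Subtype.ext (congrArg (fun x : Finset.Icc 1 n => (x : ℕ)) hij)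
    exact h.comp (fun i (r : ℕ) => ((r : ℝ) - ((n : ℝ) - (i : ℕ)) / 2) / (n : ℝ) ^ (3 / 2 : ℝ))
      fun i => measurable_from_nat
  · filter_upwards [hkn] with n hn i hi
    have hi' := hmem n i hn hi
    have hfin : (Set.Icc 0 (n - i)).Finite := Set.finite_Icc _ _
    have hprob := isProbabilityMeasure_uniformOn hfin ⟨0, by simp⟩
    have hae : ∀ᵐ r ∂((P n).map (R n i)), r ∈ Set.Icc 0 (n - i) := by
      rw [(hunif n i hi').map_eq]
      exact (prob_compl_eq_zero_iff hfin.measurableSet).2 (uniformOn_self hfin ⟨0, by simp⟩)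
    filter_upwards [ae_of_ae_map (hmeas n i) hae] with ω hω
    have h1 : (R n i ω : ℝ) ≤ (n : ℝ) - i := by
      rw [← hcast n i hi']
      exact_mod_cast hω.2
    have h0 : (0 : ℝ) ≤ R n i ω := Nat.cast_nonneg _
    have hi0 : (0 : ℝ) ≤ i := Nat.cast_nonneg _
    rw [abs_div, abs_of_nonneg (by positivity : 0 ≤ (n : ℝ) ^ (3 / 2 : ℝ))]
    gcongr
    rw [abs_le]
    constructor <;> linarith
  · filter_upwards [hkn] with n hn i hi
    have hi' := hmem n i hn hi
    rw [integral_div, ← hcast n i hi']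
    have h := (hunif n i hi').integral_comp
      (f := fun r : ℕ => (r : ℝ) - ((n - i : ℕ) : ℝ) / 2) measurable_from_nat.aestronglyMeasurable
    rw [integral_uniformOn_Icc_sub_half] at h
    simp only [Function.comp_def] at h
    rw [h, zero_div]
  · have h3 : Tendsto (fun n : ℕ => ((⌊s n⌋₊ : ℝ) / n) * ((n : ℝ) / (n : ℝ) ^ (3 / 2 : ℝ)))
        atTop (𝓝 0) := by
      simpa using hk.mul hB
    refine h3.congr' ?_
    filter_upwards [eventually_gt_atTop 0] with n hn
    have hn' : (0 : ℝ) < n := by exact_mod_cast hn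
    have hr : (0 : ℝ) < (n : ℝ) ^ (3 / 2 : ℝ) := by positivity
    have hq : ((n : ℝ) / (n : ℝ) ^ (3 / 2 : ℝ)) ^ 3
        = ((n : ℝ) / (n : ℝ) ^ (3 / 2 : ℝ)) / n := by
      rw [pow_succ, div_pow, hroot]
      field_simp
    simp only [Nat.card_Icc, Nat.add_sub_cancel]
    rw [hq]
    ring
  · have ha3 : 0 ≤ (1 - (1 - a) ^ 3) / 36 := by
      have : (1 - a) ^ 3 ≤ 1 := pow_le_one₀ (by linarith [ha.2]) (by linarith [ha.1])
      linarith
    rw [Real.coe_toNNReal _ ha3]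
    refine (tendsto_sum_sub_add_one_sq_div hk).congr' ?_
    filter_upwards [hkn] with n hn
    refine Finset.sum_congr rfl fun i hi => ?_
    have hi' := hmem n i hn hi
    simp_rw [div_pow, hroot, ← hcast n i hi']
    rw [integral_div]
    have h := (hunif n i hi').integral_comp
      (f := fun r : ℕ => ((r : ℝ) - ((n - i : ℕ) : ℝ) / 2) ^ 2)
      measurable_from_nat.aestronglyMeasurable
    rw [integral_uniformOn_Icc_sub_half_sq] at h
    simp only [Function.comp_def] at h
    rw [h]
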